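/- Let $(\Omega,\mathcal F,P)$ be the standard probability space: $\Omega=[0,1]$ with its Borel sigma-algebra $\mathcal F$ and the uniform probability measure $P$. Let $p\in[1,\infty)$, $q\in(1,\infty]$ with $1/p+1/q=1$, let $\mathcal G\subset\mathcal F$ be a sigma-subalgebra, and put $\mathcal Z=L_p(\Omega,\mathcal F,P)$, $\hat{\mathcal Z}=L_p(\Omega,\mathcal G,P)\subset\mathcal Z$ and $\hat{\mathcal Z}^*=L_q(\Omega,\mathcal G,P)$. A real-valued functional $\rho$ on $\mathcal Z$ (or on $\hat{\mathcal Z}$) is a coherent risk measure if it is monotone ($Z\ge Z'$ a.e. implies $\rho(Z)\ge\rho(Z')$), convex, translation equivariant ($\rho(Z+a)=\rho(Z)+a$ for $a\in\mathbb R$) and positively homogeneous ($\rho(tZ)=t\rho(Z)$ for $t\ge 0$). It is law invariant if $\rho(Z_1)=\rho(Z_2)$ whenever $Z_1,Z_2$ have the same cumulative distribution function. Let $\mathfrak F$ be the set of bijections $T:\Omega\to\Omega$ such that $T(A)\in\mathcal F$ and $P(T(A))=P(A)$ for all $A\in\mathcal F$, and let $\mathfrak G$ be the set of $T\in\mathfrak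 F$ such that $T(A)\in\mathcal G$ for all $A\in\mathcal G$. Assume the following condition. (A) For every $\eta\in\hat{\mathcal Z}^*$ with $\eta\ge 0$ there exist a nondecreasing right-continuous function $\zeta:[0,1)\to\mathbb R$ and $T\in\mathfrak G$ such that $\eta=\zeta\circ T$ almost everywhere. Then every law invariant coherent risk measure $\varrho:\hat{\mathcal Z}\to\mathbb R$ is regular, that is, there is a law invariant coherent risk measure $\rho:\mathcal Z\to\mathbb R$ whose restriction to $\hat{\mathcal Z}$ is $\varrho$. Moreover $\varrho$ has a Kusuoka representation: there is a set $\mathfrak M$ of probability measures on $[0,1]$ with no mass at $1$ such that for every $Y\in\hat{\mathcal Z}$ $$\varrho(Y)=\sup_{\mu\in\mathfrak M}\int_0^1 \mathsf{AV@R}_\alpha(Y)\,d\mu(\alpha),\qquad \mathsf{AV@R}_\alpha(Y)=\inf_{t\in\mathbb R}\bigl\{t+(1-\alpha)^{-1}\mathbb E[Y-t]_+\bigr\},$$ where all the integrals exist and are finite. -/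

import Mathlib

open MeasureTheory Set
open scoped ENNReal

noncomputable section

namespace RiskMeasure

/-- The standard probability space `[0,1]` with its Borel sigma-algebra. -/
abbrev Omega : Type := unitInterval

/-- The Borel sigma-algebra of `[0,1]`. -/
abbrev F : MeasurableSpace Omega := Subtype.instMeasurableSpace

/-- The uniform probability measure on `[0,1]`. -/
abbrev P : Measure Omega := volume

/-- Two random variables, possibly on different probability spaces, have the same cdf. -/
def DistribEquiv {X Y : Type*} {mX : MeasurableSpace X} {mY : MeasurableSpace Y}
    (μ : Measure X) (ν : Measure Y) (f : X → ℝ) (g : Y → ℝ) : Prop :=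
  ∀ z : ℝ, μ {x | f x ≤ z} = ν {y | g y ≤ z}

/-- The axioms of a (real-valued) coherent risk measure on `L_p(X, μ)`; the order on `Lp` is the
almost everywhere order. -/
structure IsCoherent {X : Type*} {mX : MeasurableSpace X} {μ : Measure X} [IsFiniteMeasure μ]
    {p : ℝ≥0∞} (ρ : Lp ℝ p μ → ℝ) : Prop where
  monotone : ∀ Z Z' : Lp ℝ p μ, Z' ≤ Z → ρ Z' ≤ ρ Z
  convex : ∀ (Z Z' : Lp ℝ p μ) (t : ℝ), t ∈ Icc (0 : ℝ) 1 →
    ρ (t • Z + (1 - t) • Z') ≤ t * ρ Z + (1 - t) * ρ Z'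
  translation : ∀ (Z : Lp ℝ p μ) (a : ℝ), ρ (Z + Lp.const p μ a) = ρ Z + a
  pos_homogeneous : ∀ (Z : Lp ℝ p μ) (t : ℝ), 0 ≤ t → ρ (t • Z) = t * ρ Z

/-- Law invariance: distributionally equivalent random variables have the same risk. -/
def IsLawInvariant {X : Type*} {mX : MeasurableSpace X} {μ : Measure X}
    {p : ℝ≥0∞} (ρ : Lp ℝ p μ → ℝ) : Prop :=
  ∀ Z₁ Z₂ : Lp ℝ p μ, DistribEquiv μ μ Z₁ Z₂ → ρ Z₁ = ρ Z₂

/-- The Average Value-at-Risk `inf_t { t + (1-α)⁻¹ E[Z - t]₊ }`, meaningful for `0 ≤ α < 1`. -/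
def AVaR {X : Type*} {mX : MeasurableSpace X} (μ : Measure X) (α : ℝ) (Z : X → ℝ) : ℝ :=
  ⨅ t : ℝ, t + (1 - α)⁻¹ * ∫ x, max (Z x - t) 0 ∂μ

/-- A Kusuoka representation of a risk measure: a set `M` of probability measures on `[0,1]`
having no mass at `1` such that the risk of `Z` is `sup_{μ ∈ M} ∫ AV@R_α(Z) dμ(α)`. -/
def HasKusuokaRepresentation {X : Type*} {mX : MeasurableSpace X} {ν : Measure X} {p : ℝ≥0∞}
    (ρ : Lp ℝ p ν → ℝ) : Prop :=
  ∃ M : Set (ProbabilityMeasure unitInterval),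
    (∀ μ ∈ M, (μ : Measure unitInterval) {1} = 0) ∧
    ∀ Z : Lp ℝ p ν,
      (∀ μ ∈ M, Integrable (fun α : unitInterval => AVaR ν (α : ℝ) Z) (μ : Measure unitInterval)) ∧
      IsLUB ((fun μ : ProbabilityMeasure unitInterval =>
        ∫ α, AVaR ν (α : ℝ) Z ∂(μ : Measure unitInterval)) '' M) (ρ Z)

/-- The measure-preserving transformations of the standard space: bijections `T` such that
`P(T(A)) = P(A)` for every Borel set `A` (in particular `T(A)` is Borel). -/
def transformations : Set (Equiv.Perm Omega) :=
  {T | ∀ A : Set Omega, MeasurableSet[F] A → MeasurableSet[F] (T '' A) ∧ P (T '' A) = P A}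

/-- The measure-preserving transformations that map sets of `G` to sets of `G`. -/
def preserving (G : MeasurableSpace Omega) : Set (Equiv.Perm Omega) :=
  {T | T ∈ transformations ∧
    ∀ A : Set Omega, MeasurableSet[G] A → MeasurableSet[G] (T '' A)}

/-- The space `L_p(Ω, G, P)` for a sigma-subalgebra `G` of the Borel sigma-algebra. -/
abbrev SubLp {G : MeasurableSpace Omega} (hG : G ≤ F) (p : ℝ≥0∞) : Type :=
  Lp ℝ p (P.trim hG)

/-- The inclusion of `L_p(Ω, G, P)` into `L_p(Ω, F, P)`. -/
def incl {G : MeasurableSpace Omega} (hG : G ≤ F) (p : ℝ≥0∞) (Y : SubLp hG p) :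
    Lp ℝ p P :=
  (lpTrimToLpMeas ℝ ℝ p P hG Y : Lp ℝ p P)

/-- The inclusion does not change the random variable (up to a null set). -/
theorem incl_ae_eq {G : MeasurableSpace Omega} (hG : G ≤ F) (p : ℝ≥0∞)
    (Y : SubLp hG p) : ∀ᵐ ω ∂P, incl hG p Y ω = Y ω :=
  lpTrimToLpMeas_ae_eq hG Y

/-- Condition (A). The space `SubLp hG q` is the dual of `SubLp hG p` for conjugate exponents.
Only the values of `ζ` on `[0,1)` matter, since `T ω ≠ 1` for almost every `ω`. -/
def ConditionA {G : MeasurableSpace Omega} (hG : G ≤ F) (q : ℝ≥0∞) : Prop :=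
  ∀ η : SubLp hG q, 0 ≤ η →
    ∃ ζ : ℝ → ℝ, MonotoneOn ζ (Ico 0 1) ∧
      (∀ t ∈ Ico (0 : ℝ) 1, ContinuousWithinAt ζ (Ici t) t) ∧
      ∃ T ∈ preserving G, ∀ᵐ ω ∂P, η ω = ζ (T ω)

/-- A risk measure on `L_p(Ω, G, P)` is regular if it is the restriction of a law-invariant
coherent risk measure on `L_p` of the standard space. -/
def IsRegular {G : MeasurableSpace Omega} (hG : G ≤ F) {p : ℝ≥0∞}
    (ϱ : SubLp hG p → ℝ) : Prop :=
  ∃ ρ : Lp ℝ p P → ℝ, IsCoherent ρ ∧ IsLawInvariant ρ ∧ ∀ Y : SubLp hG p, ρ (incl hG p Y) = ϱ Y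

end RiskMeasure

end

/-! Because the transformations in (A) are bijections, (A) is very restrictive: up to null sets, `G`
is generated by `n` events of probability `1 / n`. The theorem thus reduces to a finite uniform
space.

Why `G` is finite: for `A` in `G`, (A) applied to the indicator of `Aᶜ` gives a `T` carrying `A` to
an initial segment of length `P(A)`, and the image stays in `G`
(`ConditionA.eventuallyMeasurableSet_le`). The probabilities of events are therefore closed under
differences. If they were arbitrarily small, all initial segments, hence all Borel sets, would lie
in `G` modulo null sets. Then (A) would apply to the tent function `|2x - 1|`, and the image of
`[0,1/2]` would fill exactly half of every `[0,c]`, which no measurable set does. So there is a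
least positive probability; it divides `1`, and the resulting intervals of equal length are atoms.

On `n` equally likely atoms, the risk measure is a permutation-invariant, monotone sublinear
function on `Fin n → ℝ`. Hahn-Banach gives supporting probability weights. Sorting weights and
values in the same order can only increase their pairing, and nondecreasing weights decompose into
tail sums, which are multiples of AV@R at the levels `j / n` (`IsUniformOnFin.exists_isLUB_AVaR`).
The supremum formula obtained is the Kusuoka representation. It also makes sense on all of `L_p` of
the standard space, where it defines the extension. -/

namespace RiskMeasure

/-! ### Elementary properties of AV@R -/

section AVaR

variable {X : Type*} {mX : MeasurableSpace X} {μ : Measure X} {α : ℝ} {f g : X → ℝ}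

theorem one_le_inv_one_sub (h0 : 0 ≤ α) (h1 : α < 1) : 1 ≤ (1 - α)⁻¹ :=
  (one_le_inv₀ (by linarith)).2 (by linarith)

theorem integrable_max_sub [IsFiniteMeasure μ] (hf : Integrable f μ) (t : ℝ) :
    Integrable (fun x => max (f x - t) 0) μ :=
  (hf.sub (integrable_const t)).sup (integrable_const 0)

theorem integral_le_AVaR_objective [IsProbabilityMeasure μ] (h0 : 0 ≤ α) (h1 : α < 1)
    (hf : Integrable f μ) (t : ℝ) :
    ∫ x, f x ∂μ ≤ t + (1 - α)⁻¹ * ∫ x, max (f x - t) 0 ∂μ := by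
  have h2 : ∫ x, (f x - t) ∂μ ≤ ∫ x, max (f x - t) 0 ∂μ :=
    integral_mono (hf.sub (integrable_const t)) (integrable_max_sub hf t)
      fun x => le_max_left _ _
  have h3 : 0 ≤ ∫ x, max (f x - t) 0 ∂μ := integral_nonneg fun x => le_max_right _ _
  rw [integral_sub hf (integrable_const t)] at h2
  simp only [integral_const, probReal_univ, one_smul] at h2
  nlinarith [one_le_inv_one_sub h0 h1]

theorem bddBelow_AVaR_objective [IsProbabilityMeasure μ] (h0 : 0 ≤ α) (h1 : α < 1)
    (hf : Integrable f μ) :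
    BddBelow (range fun t : ℝ => t + (1 - α)⁻¹ * ∫ x, max (f x - t) 0 ∂μ) :=
  ⟨∫ x, f x ∂μ, by
    rintro _ ⟨t, rfl⟩
    exact integral_le_AVaR_objective h0 h1 hf t⟩

theorem AVaR_mono [IsProbabilityMeasure μ] (h0 : 0 ≤ α) (h1 : α < 1)
    (hf : Integrable f μ) (hg : Integrable g μ) (hfg : f ≤ᵐ[μ] g) : AVaR μ α f ≤ AVaR μ α g := by
  refine ciInf_mono (bddBelow_AVaR_objective h0 h1 hf) fun t => ?_
  have h2 : 0 ≤ (1 - α)⁻¹ := zero_le_one.trans (one_le_inv_one_sub h0 h1)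
  have h3 : ∫ x, max (f x - t) 0 ∂μ ≤ ∫ x, max (g x - t) 0 ∂μ := by
    refine integral_mono_ae (integrable_max_sub hf t) (integrable_max_sub hg t) ?_
    filter_upwards [hfg] with x hx
    exact max_le_max (by linarith) le_rfl
  gcongr

theorem AVaR_congr_ae (hfg : f =ᵐ[μ] g) : AVaR μ α f = AVaR μ α g := by
  unfold AVaR
  congr 1
  ext t
  congr 2
  refine integral_congr_ae ?_
  filter_upwards [hfg] with x hx
  rw [hx]

theorem AVaR_add_le [IsProbabilityMeasure μ] (h0 : 0 ≤ α) (h1 : α < 1)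
    (hf : Integrable f μ) (hg : Integrable g μ) :
    AVaR μ α (fun x => f x + g x) ≤ AVaR μ α f + AVaR μ α g := by
  refine le_ciInf_add_ciInf fun s t => ?_
  refine (ciInf_le (bddBelow_AVaR_objective h0 h1 (hf.add hg)) (s + t)).trans ?_
  have h2 : 0 ≤ (1 - α)⁻¹ := zero_le_one.trans (one_le_inv_one_sub h0 h1)
  have h3 : ∫ x, max ((f + g) x - (s + t)) 0 ∂μ
      ≤ ∫ x, max (f x - s) 0 ∂μ + ∫ x, max (g x - t) 0 ∂μ := by
    rw [← integral_add (integrable_max_sub hf s) (integrable_max_sub hg t)]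
    refine integral_mono (integrable_max_sub (hf.add hg) _)
      ((integrable_max_sub hf s).add (integrable_max_sub hg t)) fun x => ?_
    refine max_le ?_ (add_nonneg (le_max_right _ _) (le_max_right _ _))
    have := le_max_left (f x - s) 0
    have := le_max_left (g x - t) 0
    simp only [Pi.add_apply]
    linarith
  nlinarith [mul_le_mul_of_nonneg_left h3 h2]

theorem AVaR_add_const [IsProbabilityMeasure μ] (h0 : 0 ≤ α) (h1 : α < 1)
    (hf : Integrable f μ) (a : ℝ) : AVaR μ α (fun x => f x + a) = AVaR μ α f + a := by
  unfold AVaR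
  rw [ciInf_add (bddBelow_AVaR_objective h0 h1 hf)]
  rw [← (Equiv.addRight a).iInf_comp]
  congr 1
  ext t
  simp only [Equiv.coe_addRight, add_sub_add_right_eq_sub]
  ring

theorem AVaR_zero [IsProbabilityMeasure μ] (h0 : 0 ≤ α) (h1 : α < 1) :
    AVaR μ α (fun _ => 0) = 0 := by
  refine le_antisymm ?_ ?_
  · refine (ciInf_le (bddBelow_AVaR_objective h0 h1 (integrable_const 0)) 0).trans (by simp)
  · refine le_ciInf fun t => ?_
    simpa using integral_le_AVaR_objective (μ := μ) h0 h1 (integrable_const 0) t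

theorem AVaR_const_mul [IsProbabilityMeasure μ] (h0 : 0 ≤ α) (h1 : α < 1)
    {s : ℝ} (hs : 0 ≤ s) : AVaR μ α (fun x => s * f x) = s * AVaR μ α f := by
  rcases hs.eq_or_lt with rfl | hs
  · simpa using AVaR_zero h0 h1
  unfold AVaR
  rw [Real.mul_iInf_of_nonneg hs.le, ← (Equiv.mulLeft₀ s hs.ne').iInf_comp]
  congr 1
  ext t
  have h3 : Equiv.mulLeft₀ s hs.ne' t = s * t := rfl
  have h2 : ∀ x, max (s * f x - s * t) 0 = s * max (f x - t) 0 := fun x => by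
    rw [mul_max_of_nonneg _ _ hs.le, mul_zero, mul_sub]
  simp only [h3, h2, integral_const_mul]
  ring

theorem AVaR_eq_integral_map (hf : AEMeasurable f μ) :
    AVaR μ α f = ⨅ t : ℝ, t + (1 - α)⁻¹ * ∫ y, max (y - t) 0 ∂(μ.map f) := by
  unfold AVaR
  congr 1
  ext t
  rw [integral_map hf (by fun_prop)]

theorem DistribEquiv.map_eq {Y : Type*} {mY : MeasurableSpace Y} {ν : Measure Y} {h : Y → ℝ}
    [IsFiniteMeasure μ] (hfh : DistribEquiv μ ν f h) (hf : AEMeasurable f μ)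
    (hh : AEMeasurable h ν) : μ.map f = ν.map h := by
  refine Measure.ext_of_Iic _ _ fun a => ?_
  rw [Measure.map_apply_of_aemeasurable hf measurableSet_Iic,
    Measure.map_apply_of_aemeasurable hh measurableSet_Iic]
  exact hfh a

end AVaR

/-! ### Coherence of AV@R, of mixtures and of suprema -/

section Coherent

variable {X : Type*} {mX : MeasurableSpace X} {μ : Measure X} {p : ℝ≥0∞}

theorem isLawInvariant_AVaR [IsFiniteMeasure μ] (α : ℝ) :
    IsLawInvariant fun Z : Lp ℝ p μ => AVaR μ α Z := fun Z₁ Z₂ h => by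
  have h1 := (Lp.aestronglyMeasurable Z₁).aemeasurable
  have h2 := (Lp.aestronglyMeasurable Z₂).aemeasurable
  simp only [AVaR_eq_integral_map h1, AVaR_eq_integral_map h2, h.map_eq h1 h2]

theorem isCoherent_AVaR [IsProbabilityMeasure μ] [Fact (1 ≤ p)] {α : ℝ} (h0 : 0 ≤ α)
    (h1 : α < 1) : IsCoherent fun Z : Lp ℝ p μ => AVaR μ α Z := by
  have hint : ∀ Z : Lp ℝ p μ, Integrable Z μ := fun Z => (Lp.memLp Z).integrable Fact.out
  have hsmul : ∀ (Z : Lp ℝ p μ) (t : ℝ), 0 ≤ t → AVaR μ α (t • Z : Lp ℝ p μ) = t * AVaR μ α Z :=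
    fun Z t ht => by
      rw [← AVaR_const_mul h0 h1 ht]
      exact AVaR_congr_ae (Lp.coeFn_smul t Z)
  refine ⟨fun Z Z' h => AVaR_mono h0 h1 (hint _) (hint _) ((Lp.coeFn_le _ _).2 h),
    fun Z Z' t ht => ?_, fun Z a => ?_, hsmul⟩
  · rw [← hsmul Z t ht.1, ← hsmul Z' (1 - t) (by linarith [ht.2])]
    rw [AVaR_congr_ae (Lp.coeFn_add _ _)]
    exact AVaR_add_le h0 h1 (hint _) (hint _)
  · rw [← AVaR_add_const h0 h1 (hint Z) a]
    refine AVaR_congr_ae ?_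
    filter_upwards [Lp.coeFn_add Z (Lp.const p μ a), Lp.coeFn_const p μ a] with x hx hx'
    rw [hx, Pi.add_apply, hx', Function.const_apply]

theorem IsCoherent.weighted_sum [IsFiniteMeasure μ] {ι : Type*} [Fintype ι]
    {ρ : ι → Lp ℝ p μ → ℝ} (hρ : ∀ i, IsCoherent (ρ i)) {w : ι → ℝ} (hw : ∀ i, 0 ≤ w i)
    (hw1 : ∑ i, w i = 1) : IsCoherent fun Z => ∑ i, w i * ρ i Z := by
  refine ⟨fun Z Z' h => ?_, fun Z Z' t ht => ?_, fun Z a => ?_, fun Z t ht => ?_⟩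
  · exact Finset.sum_le_sum fun i _ =>
      mul_le_mul_of_nonneg_left ((hρ i).monotone Z Z' h) (hw i)
  · simp only [Finset.mul_sum, ← Finset.sum_add_distrib]
    refine Finset.sum_le_sum fun i _ => ?_
    refine (mul_le_mul_of_nonneg_left ((hρ i).convex Z Z' t ht) (hw i)).trans_eq ?_
    ring
  · simp only [(hρ _).translation, mul_add, Finset.sum_add_distrib, ← Finset.sum_mul, hw1,
      one_mul]
  · simp only [(hρ _).pos_homogeneous Z t ht, Finset.mul_sum]
    exact Finset.sum_congr rfl fun i _ => by ring

theorem IsCoherent.iSup [IsFiniteMeasure μ] {ι : Type*} [Nonempty ι]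
    {ρ : ι → Lp ℝ p μ → ℝ} (hρ : ∀ i, IsCoherent (ρ i))
    (hb : ∀ Z, BddAbove (range fun i => ρ i Z)) : IsCoherent fun Z => ⨆ i, ρ i Z := by
  refine ⟨fun Z Z' h => ?_, fun Z Z' t ht => ?_, fun Z a => ?_, fun Z t ht => ?_⟩
  · exact ciSup_mono (hb Z) fun i => (hρ i).monotone Z Z' h
  · refine ciSup_le fun i => ((hρ i).convex Z Z' t ht).trans ?_
    have h1 := le_ciSup (hb Z) i
    have h2 := le_ciSup (hb Z') i
    have h3 : 0 ≤ 1 - t := by linarith [ht.2]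
    have h4 := ht.1
    gcongr
  · simp only [(hρ _).translation]
    rw [ciSup_add (hb Z)]
  · simp only [(hρ _).pos_homogeneous Z t ht]
    rw [Real.mul_iSup_of_nonneg ht]

end Coherent

/-! ### Supporting weights and summation by parts -/

theorem exists_weights_of_sublinear {ι : Type*} [Fintype ι] {r : (ι → ℝ) → ℝ}
    (hmono : Monotone r) (hadd : ∀ c c', r (c + c') ≤ r c + r c')
    (hsmul : ∀ (c : ι → ℝ) (t : ℝ), 0 ≤ t → r (t • c) = t * r c)
    (hconst : ∀ a : ℝ, r (fun _ => a) = a) (c : ι → ℝ) :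
    ∃ w : ι → ℝ, (∀ i, 0 ≤ w i) ∧ ∑ i, w i = 1 ∧ (∀ c', ∑ i, w i * c' i ≤ r c') ∧
      ∑ i, w i * c i = r c := by
  classical
  have h0 : r 0 = 0 := hconst 0
  have H : ∀ k : ℝ, k • c = 0 → k • r c = 0 := fun k hk => by
    rcases smul_eq_zero.1 hk with h | h <;> simp [h, h0]
  -- Hahn-Banach starts from the line through `c`, so that the extension agrees with `r` at `c`. For
  -- negative multiples, domination follows from `0 = r 0 ≤ r (k • c) + r (-k • c)`.
  let f : (ι → ℝ) →ₗ.[ℝ] ℝ := LinearPMap.mkSpanSingleton' c (r c) H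
  have hf : ∀ k hk, f ⟨k • c, hk⟩ = k * r c := fun k hk =>
    LinearPMap.mkSpanSingleton'_apply c (r c) H k hk
  obtain ⟨g, hg1, hg2⟩ := exists_extension_of_le_sublinear f r
    (fun t ht x => hsmul x t ht.le) hadd (by
      rintro ⟨x, hx⟩
      obtain ⟨k, rfl⟩ := Submodule.mem_span_singleton.1 hx
      rw [hf]
      rcases le_total 0 k with hk | hk
      · exact (hsmul c k hk).ge
      · have h1 := hadd (k • c) ((-k) • c)
        rw [hsmul c (-k) (by linarith), ← add_smul, add_neg_cancel, zero_smul, h0] at h1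
        change k * r c ≤ r (k • c)
        linarith)
  have hsum : ∀ c' : ι → ℝ, ∑ i, g (Pi.single i 1) * c' i = g c' := fun c' => by
    rw [LinearMap.pi_apply_eq_sum_univ g c']
    refine Finset.sum_congr rfl fun i _ => ?_
    rw [smul_eq_mul, mul_comm]
    congr 2
    ext j
    simp [Pi.single_apply, eq_comm]
  refine ⟨fun i => g (Pi.single i 1), fun i => ?_, ?_, fun c' => ?_, ?_⟩
  -- Domination at minus a unit vector gives the sign; domination at the constants `1` and `-1`
  -- gives total mass one.
  · have h1 := hg2 (-Pi.single i 1)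
    have h2 : r (-Pi.single i 1) ≤ r 0 := hmono (by simp)
    rw [map_neg] at h1
    linarith
  · have h1 := hsum fun _ => 1
    have h2 := hg2 fun _ => 1
    have h3 := hg2 (-fun _ => 1)
    have h4 : r (-fun _ => 1) = -1 := hconst (-1)
    rw [hconst] at h2
    rw [map_neg] at h3
    simp only [mul_one] at h1
    linarith
  · rw [hsum]
    exact hg2 c'
  · rw [hsum]
    have hc : (1 : ℝ) • c ∈ f.domain := by
      rw [one_smul]
      exact Submodule.mem_span_singleton_self c
    have h1 := hg1 ⟨_, hc⟩
    rw [hf, one_mul] at h1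
    simpa using h1

/-- A nonnegative nondecreasing vector is a sum of nonnegative multiples of indicators of final
segments. -/
theorem exists_increments {n : ℕ} {w : Fin n → ℝ} (hw : Monotone w) (h0 : ∀ i, 0 ≤ w i) :
    ∃ d : Fin n → ℝ, (∀ j, 0 ≤ d j) ∧ ∀ i, w i = ∑ j ∈ Finset.Iic i, d j := by
  -- The shift by one with `u 0 = 0` makes the first increment `w 0` itself, so the sums telescope
  -- to `w i`.
  let u : ℕ → ℝ := fun k => if h : 0 < k ∧ k ≤ n then w ⟨k - 1, by omega⟩ else 0
  have hu : ∀ i : Fin n, u (i + 1) = w i := fun i => by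
    have : (i : ℕ) + 1 ≤ n := i.2
    simp [u, this]
  refine ⟨fun j => u (j + 1) - u j, fun j => ?_, fun i => ?_⟩
  · beta_reduce
    rw [hu, sub_nonneg]
    by_cases h : 0 < (j : ℕ) ∧ (j : ℕ) ≤ n
    · simp only [u, dif_pos h]
      exact hw (Fin.mk_le_of_le_val (Nat.sub_le _ _))
    · simp only [u, dif_neg h]
      exact h0 j
  · have h1 : ∑ j ∈ Finset.Iic i, (u (j + 1) - u j)
        = ∑ j ∈ (Finset.Iic i).map Fin.valEmbedding, (u (j + 1) - u j) := by
      rw [Finset.sum_map]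
      rfl
    rw [h1, Fin.map_valEmbedding_Iic, ← Nat.range_succ_eq_Iic, Finset.sum_range_sub, hu]
    simp [u]

theorem sum_mul_eq_sum_increments {n : ℕ} {w d : Fin n → ℝ}
    (hwd : ∀ i, w i = ∑ j ∈ Finset.Iic i, d j) (c : Fin n → ℝ) :
    ∑ i, w i * c i = ∑ j, d j * ∑ i ∈ Finset.Ici j, c i := by
  simp only [hwd, Finset.sum_mul, Finset.mul_sum]
  exact Finset.sum_comm' fun i j => by simp

/-! ### Kusuoka representation on a finite uniform space -/

section FiniteUniform

variable {Ω : Type*} {m : MeasurableSpace Ω} {μ : Measure Ω} {n : ℕ} {X : Ω → Fin n}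

/-- The random variable `X` is uniformly distributed on `Fin n`. -/
structure IsUniformOnFin (μ : Measure Ω) (X : Ω → Fin n) : Prop where
  measurable : Measurable X
  measure_preimage : ∀ k, μ (X ⁻¹' {k}) = (n : ℝ≥0∞)⁻¹

namespace IsUniformOnFin

theorem memLp_comp [IsFiniteMeasure μ] (hX : IsUniformOnFin μ X) (p : ℝ≥0∞) (c : Fin n → ℝ) :
    MemLp (fun x => c (X x)) p μ :=
  MemLp.of_bound ((measurable_of_finite c).comp hX.measurable).aestronglyMeasurable
    (∑ k, |c k|) (ae_of_all _ fun x =>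
      Finset.single_le_sum (f := fun k => |c k|) (fun _ _ => abs_nonneg _) (Finset.mem_univ (X x)))

theorem integrable_comp [IsFiniteMeasure μ] (hX : IsUniformOnFin μ X) (c : Fin n → ℝ) :
    Integrable (fun x => c (X x)) μ :=
  memLp_one_iff_integrable.1 (hX.memLp_comp 1 c)

theorem map_comp_perm (hX : IsUniformOnFin μ X) (σ : Equiv.Perm (Fin n)) :
    μ.map (fun x => σ (X x)) = μ.map X := by
  refine Measure.ext_of_singleton fun k => ?_
  change μ.map (σ ∘ X) {k} = _
  rw [Measure.map_apply ((measurable_of_finite σ).comp hX.measurable) (measurableSet_singleton k),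
    Measure.map_apply hX.measurable (measurableSet_singleton k), hX.measure_preimage]
  convert hX.measure_preimage (σ.symm k) using 2
  ext x
  simp [Equiv.eq_symm_apply]

theorem distribEquiv_comp_perm (hX : IsUniformOnFin μ X) (σ : Equiv.Perm (Fin n))
    (c : Fin n → ℝ) : DistribEquiv μ μ (fun x => c (σ (X x))) (fun x => c (X x)) := fun z => by
  have hs : MeasurableSet {k | c k ≤ z} := Set.toFinite _ |>.measurableSet
  have h1 := Measure.map_apply (μ := μ) ((measurable_of_finite σ).comp hX.measurable) hs
  have h2 := Measure.map_apply (μ := μ) hX.measurable hs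
  have h3 := hX.map_comp_perm σ
  change μ.map (fun x => σ (X x)) _ = _ at h1
  rw [h3, h2] at h1
  exact h1.symm

theorem integral_comp [IsFiniteMeasure μ] (hX : IsUniformOnFin μ X) (c : Fin n → ℝ) :
    ∫ x, c (X x) ∂μ = (n : ℝ)⁻¹ * ∑ k, c k := by
  rw [← integral_map (φ := X) (f := c) hX.measurable.aemeasurable
    (measurable_of_finite c).aestronglyMeasurable, integral_fintype Integrable.of_finite,
    Finset.mul_sum]
  refine Finset.sum_congr rfl fun k _ => ?_
  rw [map_measureReal_apply hX.measurable (measurableSet_singleton k), Measure.real,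
    hX.measure_preimage]
  simp

theorem AVaR_comp_perm [IsFiniteMeasure μ] (hX : IsUniformOnFin μ X) (σ : Equiv.Perm (Fin n))
    (c : Fin n → ℝ) (α : ℝ) :
    AVaR μ α (fun x => c (σ (X x))) = AVaR μ α (fun x => c (X x)) := by
  unfold AVaR
  congr 1
  ext t
  rw [hX.integral_comp fun k => max (c k - t) 0, hX.integral_comp fun k => max (c (σ k) - t) 0,
    Equiv.sum_comp σ fun k => max (c k - t) 0]

theorem div_mem_Ico (j : Fin n) : (j : ℝ) / n ∈ Ico (0 : ℝ) 1 := by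
  have hn : (0 : ℝ) < n := Nat.cast_pos.2 j.pos
  exact ⟨by positivity, (div_lt_one hn).2 (Nat.cast_lt.2 j.2)⟩

/-- The infimum is attained at `t = c j`, where exactly the terms of the tail survive. For any other
`t`, discarding the terms outside the tail gives the lower bound, since the tail has `n - j`
elements and the terms in `t` cancel. -/
theorem mul_AVaR_of_monotone [IsProbabilityMeasure μ] (hX : IsUniformOnFin μ X)
    {c : Fin n → ℝ} (hc : Monotone c) (j : Fin n) :
    ((n : ℝ) - j) * AVaR μ (j / n) (fun x => c (X x)) = ∑ i ∈ Finset.Ici j, c i := by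
  have hn : (0 : ℝ) < n := Nat.cast_pos.2 j.pos
  have hj : (j : ℝ) < n := Nat.cast_lt.2 j.2
  have hnj : (0 : ℝ) < n - j := sub_pos.2 hj
  have hobj : ∀ t, t + (1 - (j : ℝ) / n)⁻¹ * ∫ x, max (c (X x) - t) 0 ∂μ
      = t + ((n : ℝ) - j)⁻¹ * ∑ k, max (c k - t) 0 := fun t => by
    rw [hX.integral_comp fun k => max (c k - t) 0, ← mul_assoc, ← mul_inv]
    congr 3
    field_simp
  have hsum : ∀ t, ∑ i ∈ Finset.Ici j, (c i - t) = ∑ i ∈ Finset.Ici j, c i - (n - j) * t :=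
    fun t => by
      rw [Finset.sum_sub_distrib, Finset.sum_const, Fin.card_Ici, nsmul_eq_mul,
        Nat.cast_sub j.2.le]
  rw [mul_comm, ← eq_div_iff hnj.ne']
  refine le_antisymm ?_ ?_
  · refine (ciInf_le (bddBelow_AVaR_objective (div_mem_Ico j).1 (div_mem_Ico j).2
      (hX.integrable_comp c)) (c j)).trans ?_
    rw [hobj]
    have h1 : ∑ k, max (c k - c j) 0 = ∑ i ∈ Finset.Ici j, (c i - c j) := by
      rw [← Finset.sum_subset (Finset.subset_univ (Finset.Ici j))]
      · exact Finset.sum_congr rfl fun i hi =>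
          max_eq_left (sub_nonneg.2 (hc (Finset.mem_Ici.1 hi)))
      · intro i _ hi
        rw [Finset.mem_Ici, not_le] at hi
        exact max_eq_right (sub_nonpos.2 (hc hi.le))
    rw [h1, hsum]
    apply le_of_eq
    field_simp
    ring
  · refine le_ciInf fun t => ?_
    rw [hobj]
    have h1 : ∑ i ∈ Finset.Ici j, (c i - t) ≤ ∑ k, max (c k - t) 0 :=
      (Finset.sum_le_sum fun i _ => le_max_left _ _).trans
        (Finset.sum_le_univ_sum_of_nonneg fun i => le_max_right _ _)
    rw [hsum] at h1
    rw [div_le_iff₀ hnj, add_mul, mul_right_comm, inv_mul_cancel₀ hnj.ne', one_mul]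
    linarith

/-- A law invariant coherent risk measure over a finite uniform space is a supremum of convex
combinations of Average Values-at-Risk of the levels `j / n`. -/
theorem exists_isLUB_AVaR [IsProbabilityMeasure μ] {p : ℝ≥0∞} (hX : IsUniformOnFin μ X)
    (hrep : ∀ f : Ω → ℝ, Measurable f → ∃ c : Fin n → ℝ, f =ᵐ[μ] fun x => c (X x))
    {ρ : Lp ℝ p μ → ℝ} (hρ : IsCoherent ρ) (hlaw : IsLawInvariant ρ) :
    ∃ D : Set (Fin n → ℝ), (∀ e ∈ D, (∀ j, 0 ≤ e j) ∧ ∑ j, e j = 1) ∧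
      ∀ Y : Lp ℝ p μ, IsLUB ((fun e : Fin n → ℝ => ∑ j, e j * AVaR μ ((j : ℝ) / n) Y) '' D)
        (ρ Y) := by
  let Φ : (Fin n → ℝ) → Lp ℝ p μ := fun c => (hX.memLp_comp p c).toLp
  have hΦ : ∀ c, Φ c =ᵐ[μ] fun x => c (X x) := fun c => MemLp.coeFn_toLp _
  let r : (Fin n → ℝ) → ℝ := fun c => ρ (Φ c)
  have hsmul : ∀ (c : Fin n → ℝ) (t : ℝ), 0 ≤ t → r (t • c) = t * r c := fun c t ht =>
    hρ.pos_homogeneous (Φ c) t ht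
  have hΦ0 : ρ 0 = 0 := by simpa using hρ.pos_homogeneous 0 0 le_rfl
  have hconst : ∀ a : ℝ, r (fun _ => a) = a := fun a => by
    have h1 := hρ.translation 0 a
    rw [hΦ0, zero_add, zero_add] at h1
    refine (congrArg ρ (Lp.ext ?_)).trans h1
    filter_upwards [hΦ fun _ => a, Lp.coeFn_const p μ a] with x hx hx'
    rw [hx, hx', Function.const_apply]
  have hmono : Monotone r := fun c c' h => hρ.monotone _ _ <| by
    rw [← Lp.coeFn_le]
    filter_upwards [hΦ c, hΦ c'] with x hx hx'
    rw [hx, hx']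
    exact h _
  have hadd : ∀ c c', r (c + c') ≤ r c + r c' := fun c c' => by
    -- Subadditivity is convexity at the midpoint of `2c` and `2c'`, combined with homogeneity.
    have h1 := hρ.convex (Φ ((2 : ℝ) • c)) (Φ ((2 : ℝ) • c')) (1 / 2) ⟨by norm_num, by norm_num⟩
    have h2 := hsmul c 2 (by norm_num)
    have h3 := hsmul c' 2 (by norm_num)
    have h4 : (1 / 2 : ℝ) • Φ ((2 : ℝ) • c) + (1 - 1 / 2 : ℝ) • Φ ((2 : ℝ) • c') = Φ (c + c') := by
      have h5 : Φ ((1 / 2 : ℝ) • (2 : ℝ) • c + (1 - 1 / 2 : ℝ) • (2 : ℝ) • c') = Φ (c + c') := by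
        congr 1
        rw [smul_smul, smul_smul]
        norm_num
      exact h5
    rw [h4] at h1
    change r (c + c') ≤ 1 / 2 * r ((2 : ℝ) • c) + (1 - 1 / 2) * r ((2 : ℝ) • c') at h1
    rw [h2, h3] at h1
    linarith
  have hperm : ∀ (c : Fin n → ℝ) (σ : Equiv.Perm (Fin n)), r (fun i => c (σ i)) = r c :=
    fun c σ => hlaw _ _ fun z => by
      have h1 := hX.distribEquiv_comp_perm σ c z
      refine (measure_congr ?_).trans (h1.trans (measure_congr ?_))
      · filter_upwards [hΦ fun i => c (σ i)] with x hx
        simp only [eq_iff_iff]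
        change _ ≤ z ↔ _ ≤ z
        rw [hx]
      · filter_upwards [hΦ c] with x hx
        simp only [eq_iff_iff]
        change _ ≤ z ↔ _ ≤ z
        rw [hx]
  -- Here `d` holds the increments of nondecreasing weights whose pairing is dominated by `r`. The
  -- factor `n - j` turns a tail sum of sorted values into AV@R at level `j / n`.
  refine ⟨{e | ∃ d : Fin n → ℝ, (∀ j, 0 ≤ d j) ∧ (∀ j, e j = d j * (n - j)) ∧ ∑ j, e j = 1 ∧
    ∀ c : Fin n → ℝ, ∑ j, d j * ∑ i ∈ Finset.Ici j, c i ≤ r c}, ?_, fun Y => ?_⟩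
  · rintro e ⟨d, hd, he, he1, -⟩
    refine ⟨fun j => ?_, he1⟩
    rw [he]
    exact mul_nonneg (hd j) (sub_nonneg.2 (Nat.cast_le.2 j.2.le))
  · obtain ⟨c, hc⟩ := hrep Y (Lp.stronglyMeasurable Y).measurable
    have hY : Y = Φ c := Lp.ext (hc.trans (hΦ c).symm)
    set s : Fin n → ℝ := fun i => c (Tuple.sort c i) with hs
    have hsmono : Monotone s := Tuple.monotone_sort c
    have hval : ∀ d : Fin n → ℝ, ∑ j, d j * ((n : ℝ) - j) * AVaR μ ((j : ℝ) / n) Y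
        = ∑ j, d j * ∑ i ∈ Finset.Ici j, s i := fun d => by
      refine Finset.sum_congr rfl fun j _ => ?_
      rw [mul_assoc, ← hX.mul_AVaR_of_monotone hsmono, hX.AVaR_comp_perm, AVaR_congr_ae hc]
    have hρY : ρ Y = r s := by rw [hY, hs, hperm]
    refine ⟨?_, fun b hb => ?_⟩
    · rintro _ ⟨e, ⟨d, hd, he, he1, hdr⟩, rfl⟩
      simp only [he]
      rw [hval, hρY]
      exact hdr s
    · obtain ⟨w, hw0, hw1, hwr, hws⟩ := exists_weights_of_sublinear hmono hadd hsmul hconst s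
      set τ := Tuple.sort w with hτ
      have hwmono : Monotone fun i => w (τ i) := Tuple.monotone_sort w
      obtain ⟨d, hd, hwd⟩ := exists_increments hwmono fun i => hw0 _
      have hsum := sum_mul_eq_sum_increments hwd
      -- Rearrangement inequality: pairing sorted weights with sorted values loses nothing. The
      -- sorted weights remain dominated because `r` is permutation invariant.
      have hle : r s ≤ ∑ i, w (τ i) * s i := by
        rw [← hws]
        have h1 := (hwmono.monovary hsmono).sum_comp_perm_mul_le_sum_mul (σ := τ.symm)
        simpa using h1
      rw [hρY]
      refine hle.trans ((hsum s).trans_le ?_)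
      rw [← hval]
      refine hb ⟨fun j => d j * (n - j), ⟨d, hd, fun j => rfl, ?_, fun c' => ?_⟩, rfl⟩
      · have h1 := hsum fun _ => 1
        simp only [mul_one, Equiv.sum_comp τ w, hw1, Finset.sum_const, Fin.card_Ici, nsmul_eq_mul]
          at h1
        rw [h1]
        exact Finset.sum_congr rfl fun j _ => by rw [Nat.cast_sub j.2.le]
      · rw [← hsum, ← hperm c' τ.symm, ← Equiv.sum_comp τ.symm]
        simpa using hwr fun i => c' (τ.symm i)

end IsUniformOnFin

end FiniteUniform

/-! ### Suprema of mixtures over finitely many levels -/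

section FiniteLevels

variable {X : Type*} {mX : MeasurableSpace X} {μ : Measure X} {p : ℝ≥0∞} {n : ℕ}
  {D : Set (Fin n → ℝ)}

theorem hasKusuokaRepresentation_of_isLUB (hD : ∀ e ∈ D, (∀ j, 0 ≤ e j) ∧ ∑ j, e j = 1)
    {ρ : Lp ℝ p μ → ℝ}
    (hρ : ∀ Y : Lp ℝ p μ,
      IsLUB ((fun e : Fin n → ℝ => ∑ j, e j * AVaR μ ((j : ℝ) / n) Y) '' D) (ρ Y)) :
    HasKusuokaRepresentation ρ := by
  let lvl : Fin n → unitInterval := fun j =>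
    ⟨(j : ℝ) / n, Ico_subset_Icc_self (IsUniformOnFin.div_mem_Ico j)⟩
  let mix : (Fin n → ℝ) → Measure unitInterval := fun e =>
    ∑ j, ENNReal.ofReal (e j) • Measure.dirac (lvl j)
  have hmix : ∀ e ∈ D, IsProbabilityMeasure (mix e) := fun e he => ⟨by
    simp only [mix, Measure.finsetSum_apply, Measure.smul_apply, measure_univ, smul_eq_mul,
      mul_one]
    rw [← ENNReal.ofReal_sum_of_nonneg fun j _ => (hD e he).1 j, (hD e he).2, ENNReal.ofReal_one]⟩
  have hint : ∀ (e : Fin n → ℝ) (f : unitInterval → ℝ), Integrable f (mix e) := fun e f =>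
    integrable_finsetSum_measure.2 fun j _ =>
      (integrable_dirac enorm_lt_top).smul_measure ENNReal.ofReal_ne_top
  have hval : ∀ e ∈ D, ∀ f : unitInterval → ℝ, ∫ a, f a ∂(mix e) = ∑ j, e j * f (lvl j) :=
    fun e he f => by
      rw [integral_finsetSum_measure fun j _ =>
        (integrable_dirac enorm_lt_top).smul_measure ENNReal.ofReal_ne_top]
      refine Finset.sum_congr rfl fun j _ => ?_
      rw [integral_smul_measure, integral_dirac, ENNReal.toReal_ofReal ((hD e he).1 j),
        smul_eq_mul]
  refine ⟨{ν | ∃ e ∈ D, (ν : Measure unitInterval) = mix e}, ?_, fun Z => ⟨?_, ?_⟩⟩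
  · rintro ν ⟨e, -, hν⟩
    have h1 : ∀ j, lvl j ≠ 1 := fun j h =>
      (IsUniformOnFin.div_mem_Ico j).2.ne (congrArg Subtype.val h)
    rw [hν]
    simp [mix, h1]
  · rintro ν ⟨e, -, hν⟩
    rw [hν]
    exact hint e _
  · convert hρ Z using 1
    ext y
    constructor
    · rintro ⟨ν, ⟨e, he, hν⟩, rfl⟩
      refine ⟨e, he, ?_⟩
      beta_reduce
      rw [hν, hval e he]
    · rintro ⟨e, he, rfl⟩
      exact ⟨⟨mix e, hmix e he⟩, ⟨e, he, rfl⟩, hval e he _⟩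

/-- The bound does not depend on `e`, so the supremum over `D` is finite on every `L_p` space, in
particular for the extension. -/
theorem sum_mul_le_sum_abs {e : Fin n → ℝ} (he : ∀ j, 0 ≤ e j) (he1 : ∑ j, e j = 1)
    (a : Fin n → ℝ) : ∑ j, e j * a j ≤ ∑ j, |a j| := by
  refine Finset.sum_le_sum fun j _ => ?_
  have h1 : e j ≤ 1 := he1 ▸ Finset.single_le_sum (fun i _ => he i) (Finset.mem_univ j)
  calc e j * a j ≤ e j * |a j| := mul_le_mul_of_nonneg_left (le_abs_self _) (he j)
    _ ≤ 1 * |a j| := mul_le_mul_of_nonneg_right h1 (abs_nonneg _)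
    _ = |a j| := one_mul _

theorem isCoherent_iSup_AVaR [IsProbabilityMeasure μ] [Fact (1 ≤ p)]
    (hD : ∀ e ∈ D, (∀ j, 0 ≤ e j) ∧ ∑ j, e j = 1) (hne : D.Nonempty) :
    IsCoherent fun Z : Lp ℝ p μ => ⨆ e : D, ∑ j, e.1 j * AVaR μ ((j : ℝ) / n) Z := by
  have : Nonempty D := hne.to_subtype
  refine IsCoherent.iSup (ρ := fun (e : D) (Z : Lp ℝ p μ) =>
    ∑ j, e.1 j * AVaR μ ((j : ℝ) / n) Z) (fun e => ?_) fun Z => ?_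
  · exact IsCoherent.weighted_sum (fun j => isCoherent_AVaR (IsUniformOnFin.div_mem_Ico j).1
      (IsUniformOnFin.div_mem_Ico j).2) (hD e e.2).1 (hD e e.2).2
  · refine ⟨∑ j : Fin n, |AVaR μ ((j : ℝ) / n) Z|, ?_⟩
    rintro _ ⟨e, rfl⟩
    exact sum_mul_le_sum_abs (hD e e.2).1 (hD e e.2).2 _

theorem isLawInvariant_iSup_AVaR [IsFiniteMeasure μ] (D : Set (Fin n → ℝ)) :
    IsLawInvariant fun Z : Lp ℝ p μ => ⨆ e : D, ∑ j, e.1 j * AVaR μ ((j : ℝ) / n) Z :=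
  fun Z₁ Z₂ h => by
    have h1 : ∀ α, AVaR μ α Z₁ = AVaR μ α Z₂ := fun α => isLawInvariant_AVaR α Z₁ Z₂ h
    simp only [h1]

end FiniteLevels

/-! ### Extension to the standard space -/

theorem AVaR_incl {G : MeasurableSpace Omega} (hG : G ≤ F) {p : ℝ≥0∞} (α : ℝ)
    (Y : SubLp hG p) : AVaR P α (incl hG p Y) = AVaR (P.trim hG) α Y := by
  rw [AVaR_congr_ae (incl_ae_eq hG p Y)]
  unfold AVaR
  congr 1
  ext t
  rw [integral_trim hG]
  have h1 : StronglyMeasurable[G] Y := Lp.stronglyMeasurable Y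
  exact (h1.sub stronglyMeasurable_const).sup stronglyMeasurable_const

/-- The theorem for a sub-sigma-algebra that is, up to null sets, generated by `n` events of equal
probability. -/
theorem isRegular_and_hasKusuokaRepresentation_of_isUniformOnFin {G : MeasurableSpace Omega}
    (hG : G ≤ F) {p : ℝ≥0∞} (hp : 1 ≤ p) {n : ℕ} {X : Omega → Fin n}
    (hX : IsUniformOnFin (P.trim hG) X)
    (hrep : ∀ f : Omega → ℝ, Measurable[G] f →
      ∃ c : Fin n → ℝ, f =ᵐ[P.trim hG] fun x => c (X x))
    {ϱ : SubLp hG p → ℝ} (hcoh : IsCoherent ϱ) (hlaw : IsLawInvariant ϱ) :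
    IsRegular hG ϱ ∧ HasKusuokaRepresentation ϱ := by
  have : Fact (1 ≤ p) := ⟨hp⟩
  have : IsProbabilityMeasure (P.trim hG) := ⟨by
    rw [trim_measurableSet_eq hG MeasurableSet.univ, measure_univ]⟩
  obtain ⟨D, hD, hlub⟩ := hX.exists_isLUB_AVaR hrep hcoh hlaw
  -- The empty set has no least upper bound in `ℝ`.
  have hne : D.Nonempty := image_nonempty.1 (hlub 0).nonempty
  have : Nonempty D := hne.to_subtype
  refine ⟨⟨fun Z => ⨆ e : D, ∑ j, e.1 j * AVaR P ((j : ℝ) / n) Z, isCoherent_iSup_AVaR hD hne,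
    isLawInvariant_iSup_AVaR D, fun Y => ?_⟩, hasKusuokaRepresentation_of_isLUB hD hlub⟩
  simp only [AVaR_incl]
  refine IsLUB.ciSup_eq ?_
  have h1 := hlub Y
  rwa [image_eq_range] at h1

/-! ### Images of sublevel sets under measure-preserving bijections -/

theorem _root_.IsLowerSet.exists_ae_eq_Iic {S : Set Omega} (hS : IsLowerSet S) :
    ∃ s : Omega, S =ᵐ[P] Iic s := by
  refine ⟨sSup S, ?_⟩
  filter_upwards [compl_mem_ae_iff.2 (measure_singleton (μ := P) (sSup S))] with x hx
  refine propext ⟨fun h => le_sSup h, fun h => ?_⟩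
  obtain ⟨y, hy, hxy⟩ := lt_sSup_iff.1 (lt_of_le_of_ne h hx)
  exact hS hxy.le hy

theorem measure_image_eq {T : Equiv.Perm Omega} (hT : T ∈ transformations) {A : Set Omega}
    (hA : MeasurableSet[F] A) : P (T '' A) = P A :=
  (hT A hA).2

theorem image_ae_eq_image {T : Equiv.Perm Omega} (hT : T ∈ transformations) {A B : Set Omega}
    (h : A =ᵐ[P] B) : T '' A =ᵐ[P] T '' B := by
  -- A null set need not be Borel, so it is first enclosed in a Borel null set.
  have hnull : ∀ N : Set Omega, P N = 0 → P (T '' N) = 0 := fun N hN =>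
    measure_mono_null (image_mono (subset_toMeasurable P N)) <| by
      rw [measure_image_eq hT (measurableSet_toMeasurable P N), measure_toMeasurable, hN]
  rw [ae_eq_set] at h ⊢
  rw [← image_sdiff T.injective, ← image_sdiff T.injective]
  exact ⟨hnull _ h.1, hnull _ h.2⟩

theorem measurable_tent : Measurable fun x : Omega => |2 * (x : ℝ) - 1| := by
  fun_prop

variable {G : MeasurableSpace Omega}

/-- If `η = ζ ∘ T` almost everywhere, `T` carries `{η ≤ c}` onto `{ζ ≤ c}` modulo null sets, and the
latter is a lower set by monotonicity. One `T` serves all `c`. -/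
theorem ConditionA.exists_image_sublevel_ae_eq {hG : G ≤ F} {q : ℝ≥0∞} (hA : ConditionA hG q)
    {η : Omega → ℝ} (hη : Measurable[G] η) (hLq : MemLp η q P) (h0 : 0 ≤ᵐ[P] η) :
    ∃ T ∈ preserving G, ∀ c : ℝ, ∃ s : Omega, T '' {x | η x ≤ c} =ᵐ[P] Iic s := by
  have hsm : StronglyMeasurable[G] η := hη.stronglyMeasurable
  have hLq' : MemLp η q (P.trim hG) :=
    ⟨hsm.aestronglyMeasurable, (eLpNorm_trim hG hsm).trans_lt hLq.2⟩
  have h0' : 0 ≤ hLq'.toLp := by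
    rw [← Lp.coeFn_nonneg]
    have h1 : 0 ≤ᵐ[P.trim hG] η :=
      (StronglyMeasurable.ae_le_trim_iff hG stronglyMeasurable_zero hsm).2 h0
    filter_upwards [h1, hLq'.coeFn_toLp] with x hx hx'
    rwa [hx']
  obtain ⟨ζ, hζ, -, T, hT, hηT⟩ := hA hLq'.toLp h0'
  refine ⟨T, hT, fun c => ?_⟩
  have h1 : {x | η x ≤ c} =ᵐ[P] T ⁻¹' {y | ζ y ≤ c} := by
    filter_upwards [hηT, ae_of_ae_trim hG hLq'.coeFn_toLp] with x hx hx'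
    rw [hx'] at hx
    exact propext (by
      change η x ≤ c ↔ ζ (T x) ≤ c
      rw [hx])
  have h2 := image_ae_eq_image hT.1 h1
  rw [image_preimage_eq _ T.surjective] at h2
  -- The point `1` is removed because nothing is known about `ζ` there.
  have h3 : IsLowerSet ({y : Omega | ζ y ≤ c} \ {1}) := by
    rintro x y hyx ⟨hx, hx1⟩
    have hx2 : x < 1 := lt_of_le_of_ne unitInterval.le_one' hx1
    have hy2 : y < 1 := hyx.trans_lt hx2
    exact ⟨(hζ ⟨y.2.1, hy2⟩ ⟨x.2.1, hx2⟩ hyx).trans hx, hy2.ne⟩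
  obtain ⟨s, hs⟩ := h3.exists_ae_eq_Iic
  refine ⟨s, h2.trans (Filter.EventuallyEq.trans ?_ hs)⟩
  exact (sdiff_null_ae_eq_self (measure_singleton _)).symm

/-! ### The probabilities of events under condition (A) -/

/-- The probabilities of the events of `G`. -/
def eventProbs (G : MeasurableSpace Omega) : Set ℝ :=
  {v | ∃ A, MeasurableSet[G] A ∧ P.real A = v}

theorem eventProbs_subset : eventProbs G ⊆ Icc 0 1 := by
  rintro _ ⟨A, -, rfl⟩
  exact ⟨measureReal_nonneg, measureReal_le_one⟩

theorem volume_real_Iic (x : Omega) : P.real (Iic x) = x := by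
  rw [Measure.real, unitInterval.volume_Iic, ENNReal.toReal_ofReal x.2.1]

theorem volume_real_le {v : ℝ} (hv : v ∈ Icc (0 : ℝ) 1) : P.real {x : Omega | (x : ℝ) ≤ v} = v :=
  volume_real_Iic ⟨v, hv⟩

theorem volume_real_Icc {a b : ℝ} (ha : 0 ≤ a) (hab : a ≤ b) (hb : b ≤ 1) :
    P.real {x : Omega | a ≤ (x : ℝ) ∧ (x : ℝ) ≤ b} = b - a := by
  have h1 := unitInterval.volume_Icc ⟨a, ha, hab.trans hb⟩ ⟨b, ha.trans hab, hb⟩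
  change P {x : Omega | a ≤ (x : ℝ) ∧ (x : ℝ) ≤ b} = _ at h1
  rw [Measure.real, h1, ENNReal.toReal_ofReal (sub_nonneg.2 hab)]

theorem volume_real_sdiff_le {v w : ℝ} (hv : 0 ≤ v) (hvw : v ≤ w) (hw : w ≤ 1) :
    P.real ({x : Omega | (x : ℝ) ≤ w} \ {x : Omega | (x : ℝ) ≤ v}) = w - v := by
  have hsub : {x : Omega | (x : ℝ) ≤ v} ⊆ {x : Omega | (x : ℝ) ≤ w} := fun x hx =>
    le_trans hx hvw
  rw [measureReal_sdiff hsub (measurableSet_le measurable_subtype_coe measurable_const),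
    volume_real_le ⟨hv, hvw.trans hw⟩, volume_real_le ⟨hv.trans hvw, hw⟩]

theorem ConditionA.eventuallyMeasurableSet_le {hG : G ≤ F} {q : ℝ≥0∞} (hA : ConditionA hG q)
    {v : ℝ} (hv : v ∈ eventProbs G) :
    EventuallyMeasurableSet G (ae P) {x : Omega | (x : ℝ) ≤ v} := by
  obtain ⟨A, hAG, rfl⟩ := hv
  -- The complement is used so that `A` is the sublevel set at `0`.
  have hm : Measurable[G] (Aᶜ.indicator fun _ => (1 : ℝ)) :=
    (@measurable_const _ _ _ G 1).indicator hAG.compl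
  have hind : ∀ x, Aᶜ.indicator (fun _ => (1 : ℝ)) x ∈ Icc (0 : ℝ) 1 := fun x => by
    by_cases hx : x ∈ A <;> simp [hx]
  obtain ⟨T, hT, hTs⟩ := hA.exists_image_sublevel_ae_eq hm
    (MemLp.of_bound (hm.mono hG le_rfl).aestronglyMeasurable 1 (ae_of_all _ fun x => by
      rw [Real.norm_eq_abs, abs_of_nonneg (hind x).1]
      exact (hind x).2)) (ae_of_all _ fun x => (hind x).1)
  obtain ⟨s, hs⟩ := hTs 0
  have hA0 : {x | Aᶜ.indicator (fun _ => (1 : ℝ)) x ≤ 0} = A := by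
    ext x
    by_cases hx : x ∈ A <;> simp [hx]
  rw [hA0] at hs
  have h1 : P.real A = s := by
    rw [← volume_real_Iic, ← measureReal_congr hs, Measure.real, Measure.real,
      measure_image_eq hT.1 (hG _ hAG)]
  rw [h1]
  exact ⟨T '' A, hT.2 A hAG, hs.symm⟩

theorem mem_eventProbs_of_eventuallyMeasurableSet {A : Set Omega}
    (h : EventuallyMeasurableSet G (ae P) A) : P.real A ∈ eventProbs G := by
  obtain ⟨B, hB, hAB⟩ := h
  exact ⟨B, hB, (measureReal_congr hAB).symm⟩

theorem one_mem_eventProbs : (1 : ℝ) ∈ eventProbs G :=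
  ⟨univ, MeasurableSet.univ, probReal_univ⟩

theorem ConditionA.sub_mem_eventProbs {hG : G ≤ F} {q : ℝ≥0∞} (hA : ConditionA hG q)
    {v w : ℝ} (hv : v ∈ eventProbs G) (hw : w ∈ eventProbs G) (hvw : v ≤ w) :
    w - v ∈ eventProbs G := by
  have h1 := mem_eventProbs_of_eventuallyMeasurableSet
    (MeasurableSet.diff (hA.eventuallyMeasurableSet_le hw) (hA.eventuallyMeasurableSet_le hv))
  rwa [volume_real_sdiff_le (eventProbs_subset hv).1 hvw (eventProbs_subset hw).2] at h1

theorem ConditionA.nat_mul_mem_eventProbs {hG : G ≤ F} {q : ℝ≥0∞} (hA : ConditionA hG q)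
    {v : ℝ} (hv : v ∈ eventProbs G) (k : ℕ) (hk : k * v ≤ 1) : k * v ∈ eventProbs G := by
  have h0 := (eventProbs_subset hv).1
  -- Only differences are available, so the induction runs on the remainder `1 - k * v`; a last
  -- subtraction from `1` recovers `k * v`.
  have h1 : ∀ k : ℕ, k * v ≤ 1 → 1 - k * v ∈ eventProbs G := fun k => by
    induction k with
    | zero => intro _; simpa using one_mem_eventProbs
    | succ k ih =>
      intro hk
      push_cast at hk
      have h2 := hA.sub_mem_eventProbs hv (ih (by linarith)) (by linarith)
      convert h2 using 1
      push_cast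
      ring
  have h2 := hA.sub_mem_eventProbs (h1 k hk) one_mem_eventProbs 
    (by nlinarith [k.cast_nonneg (α := ℝ)])
  simpa using h2

/-- Simple functions are corrected set by set; the limsup of the corrected approximations is
`G`-measurable and agrees with the limit off a countable union of null sets. -/
theorem exists_measurable_ae_eq_of_eventuallyMeasurable {f : Omega → ℝ}
    (hf : EventuallyMeasurable G (ae P) f) : ∃ g : Omega → ℝ, Measurable[G] g ∧ f =ᵐ[P] g := by
  have hsimple : ∀ s : @SimpleFunc Omega (eventuallyMeasurableSpace G (ae P)) ℝ,
      ∃ g : Omega → ℝ, Measurable[G] g ∧ s =ᵐ[P] g := by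
    refine @SimpleFunc.induction _ _ (eventuallyMeasurableSpace G (ae P)) _ _ ?_ ?_
    · rintro c s ⟨t, ht, hst⟩
      refine ⟨t.indicator fun _ => c, (@measurable_const _ _ _ G c).indicator ht, ?_⟩
      filter_upwards [hst] with x hx
      have hx' : x ∈ s ↔ x ∈ t := iff_of_eq hx
      by_cases h : x ∈ s
      · rw [indicator_of_mem (hx'.1 h)]
        exact if_pos h
      · rw [indicator_of_notMem (hx'.not.1 h)]
        exact if_neg h
    · rintro s t - ⟨g, hg, hsg⟩ ⟨h, hh, hth⟩
      exact ⟨g + h, hg.add hh, hsg.add hth⟩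
  have hsm : StronglyMeasurable[eventuallyMeasurableSpace G (ae P)] f :=
    Measurable.stronglyMeasurable hf
  choose g hg hfg using fun k => hsimple (hsm.approx k)
  refine ⟨fun x => Filter.limsup (fun k => g k x) Filter.atTop, Measurable.limsup hg, ?_⟩
  filter_upwards [ae_all_iff.2 hfg] with x hx
  have h1 := hsm.tendsto_approx x
  simp only [hx] at h1
  exact h1.limsup_eq.symm

/-- Under condition (A) the sigma-algebra `G` cannot contain all Borel sets up to null sets: the tent
map would be a monotone function of a measure-preserving bijection. -/
theorem ConditionA.not_le_eventuallyMeasurableSpace {hG : G ≤ F} {q : ℝ≥0∞} (hA : ConditionA hG q)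
    :
    ¬ F ≤ eventuallyMeasurableSpace G (ae P) := by
  intro hGF
  let tent : Omega → ℝ := fun x => |2 * (x : ℝ) - 1|
  have htent : Measurable[F] tent := measurable_tent
  obtain ⟨η, hη, htη⟩ := exists_measurable_ae_eq_of_eventuallyMeasurable
    (G := G) (f := tent) (htent.mono hGF le_rfl)
  have hbound : ∀ x : Omega, |tent x| ≤ 1 := fun x => by
    have h1 := x.2.1
    have h2 := x.2.2
    rw [abs_abs, abs_le]
    constructor <;> linarith
  obtain ⟨T, hT, hTs⟩ := hA.exists_image_sublevel_ae_eq hη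
    (MemLp.of_bound (hη.mono hG le_rfl).aestronglyMeasurable 1 (by
      filter_upwards [htη] with x hx
      rw [← hx]
      exact hbound x))
    (by
      filter_upwards [htη] with x hx
      rw [← hx]
      exact abs_nonneg _)
  have hsub : ∀ c : ℝ, {x | η x ≤ c} =ᵐ[P] {x | tent x ≤ c} := fun c => by
    filter_upwards [htη] with x hx
    exact propext (by
      change η x ≤ c ↔ tent x ≤ c
      rw [hx])
  have hηm : ∀ c : ℝ, MeasurableSet[F] {x | η x ≤ c} := fun c =>
    measurableSet_le (hη.mono hG le_rfl) measurable_const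
  let A : Set Omega := {x | (x : ℝ) ≤ 1 / 2}
  have hAm : MeasurableSet[F] A := measurableSet_le measurable_subtype_coe measurable_const
  let C : Set Omega := T '' A
  have hCm : MeasurableSet[F] C := (hT.1 A hAm).1
  have hreal : ∀ B : Set Omega, MeasurableSet[F] B → P.real (T '' B) = P.real B := fun B hB => by
    rw [Measure.real, Measure.real, measure_image_eq hT.1 hB]
  -- The sublevel set of the tent at `c` is an interval of length `c`, which identifies the endpoint
  -- `s` as `c`.
  have hIic : ∀ c : Omega, T '' {x | η x ≤ c} =ᵐ[P] Iic c := fun c => by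
    obtain ⟨s, hs⟩ := hTs c
    have h1 : P.real (T '' {x | η x ≤ c}) = c := by
      rw [hreal _ (hηm c), measureReal_congr (hsub c)]
      have h2 : {x : Omega | tent x ≤ c}
          = {x : Omega | (1 - (c : ℝ)) / 2 ≤ x ∧ (x : ℝ) ≤ (1 + c) / 2} := by
        ext x
        simp only [tent, mem_ofPred_eq, abs_le]
        constructor <;> rintro ⟨h3, h4⟩ <;> constructor <;> linarith
      rw [h2, volume_real_Icc (by linarith [c.2.2]) (by linarith [c.2.1]) (by linarith [c.2.2])]
      ring
    rw [measureReal_congr hs, volume_real_Iic] at h1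
    rwa [Subtype.ext h1] at hs
  -- The tent is symmetric about `1/2`, so `A` cuts each of its sublevel sets in half.
  have hhalf : ∀ c : Omega, P.real (Iic c ∩ C) = c / 2 := fun c => by
    have h1 : (Iic c ∩ C : Set Omega) =ᵐ[P] T '' ({x | η x ≤ c} ∩ A) := by
      rw [image_inter T.injective]
      exact (hIic c).symm.inter (ae_eq_refl _)
    rw [measureReal_congr h1, hreal _ ((hηm c).inter hAm),
      measureReal_congr ((hsub c).inter (ae_eq_refl A))]
    have h2 : {x : Omega | tent x ≤ c} ∩ A
        = {x : Omega | (1 - (c : ℝ)) / 2 ≤ x ∧ (x : ℝ) ≤ 1 / 2} := by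
      ext x
      have := c.2.1
      simp only [tent, A, mem_inter_iff, mem_ofPred_eq, abs_le]
      constructor
      · rintro ⟨⟨h3, h4⟩, h5⟩
        constructor <;> linarith
      · rintro ⟨h3, h4⟩
        refine ⟨⟨?_, ?_⟩, ?_⟩ <;> linarith
    rw [h2, volume_real_Icc (by linarith [c.2.2]) (by linarith [c.2.1]) (by norm_num)]
    ring
  have hmeas : P.restrict C = (2⁻¹ : ℝ≥0∞) • P := by
    refine Measure.ext_of_Iic _ _ fun c => ?_
    rw [Measure.restrict_apply measurableSet_Iic, Measure.smul_apply, unitInterval.volume_Iic,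
      ← ofReal_measureReal, hhalf, smul_eq_mul, div_eq_inv_mul, ENNReal.ofReal_mul (by norm_num),
      ENNReal.ofReal_inv_of_pos (by norm_num)]
    norm_num
  have hC : P.real C = 1 / 2 := by
    rw [hreal A hAm]
    exact volume_real_le ⟨by norm_num, by norm_num⟩
  -- Evaluated at `C` itself, the two measures give `1/2` and `1/4`.
  have h1 : (P.restrict C).real C = ((2⁻¹ : ℝ≥0∞) • P).real C := by rw [hmeas]
  simp only [measureReal_restrict_apply_self, measureReal_ennreal_smul_apply, hC] at h1
  norm_num at h1

theorem ConditionA.exists_pos_le {hG : G ≤ F} {q : ℝ≥0∞} (hA : ConditionA hG q) :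
    ∃ ε > 0, ∀ v ∈ eventProbs G, 0 < v → ε ≤ v := by
  by_contra! hcon
  refine hA.not_le_eventuallyMeasurableSpace ?_
  have hIic : ∀ c : Omega, EventuallyMeasurableSet G (ae P) (Iic c) := fun c => by
    -- With `δ k` tending to `0`, the multiples `⌊c / δ k⌋ * δ k` approach `c` from below, so the
    -- corresponding segments exhaust `Iic c` up to its endpoint.
    choose δ hδ hδ0 hδ1 using fun k : ℕ => hcon (1 / ((k : ℝ) + 1)) (by positivity)
    have hle : ∀ k, (⌊(c : ℝ) / δ k⌋₊ : ℝ) * δ k ≤ c := fun k =>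
      (le_div_iff₀ (hδ0 k)).1 (Nat.floor_le (div_nonneg c.2.1 (hδ0 k).le))
    have hmem : ∀ k, EventuallyMeasurableSet G (ae P)
        {x : Omega | (x : ℝ) ≤ ⌊(c : ℝ) / δ k⌋₊ * δ k} := fun k =>
      hA.eventuallyMeasurableSet_le
        (hA.nat_mul_mem_eventProbs (hδ k) _ ((hle k).trans c.2.2))
    refine EventuallyMeasurableSet.congr (MeasurableSet.iUnion hmem) ?_
    filter_upwards [compl_mem_ae_iff.2 (measure_singleton (μ := P) c)] with x hx
    refine propext ⟨fun h => mem_iUnion.2 ?_, fun h => ?_⟩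
    · have hxc : (0 : ℝ) < c - x := 
        sub_pos.2 (Subtype.coe_lt_coe.2 (lt_of_le_of_ne h hx))
      obtain ⟨k, hk⟩ := exists_nat_one_div_lt hxc
      refine ⟨k, ?_⟩
      have h1 := (div_lt_iff₀ (hδ0 k)).1 (Nat.lt_floor_add_one ((c : ℝ) / δ k))
      have h2 := hδ1 k
      change (x : ℝ) ≤ _
      linarith
    · obtain ⟨k, hk⟩ := mem_iUnion.1 h
      have h1 : (x : ℝ) ≤ ⌊(c : ℝ) / δ k⌋₊ * δ k := hk
      exact Subtype.coe_le_coe.1 (h1.trans (hle k))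
  rw [@BorelSpace.measurable_eq Omega _ F _, borel_eq_generateFrom_Iic]
  refine MeasurableSpace.generateFrom_le ?_
  rintro _ ⟨c, rfl⟩
  exact hIic c

/-- The probabilities of the events of `G` are multiples of some `1 / n`. -/
theorem ConditionA.exists_nat_div_mem_eventProbs {hG : G ≤ F} {q : ℝ≥0∞} (hA : ConditionA hG q) :
    ∃ n : ℕ, 0 < n ∧ (∀ k ≤ n, (k : ℝ) / n ∈ eventProbs G) ∧
      ∀ v ∈ eventProbs G, 0 < v → 1 / (n : ℝ) ≤ v := by
  obtain ⟨ε, hε, hmin⟩ := hA.exists_pos_le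
  set S : Set ℝ := {v ∈ eventProbs G | 0 < v} with hS
  have hSne : S.Nonempty := ⟨1, one_mem_eventProbs, one_pos⟩
  have hSb : BddBelow S := ⟨ε, fun v hv => hmin v hv.1 hv.2⟩
  have hm0 : 0 < sInf S := hε.trans_le (le_csInf hSne fun v hv => hmin v hv.1 hv.2)
  -- The infimum is attained: a smaller `w` would make both `w` and `v - w` at least `sInf S`,
  -- contradicting `v < 2 * sInf S`.
  obtain ⟨v, ⟨hv, hv0⟩, hv2⟩ := exists_lt_of_csInf_lt hSne (by linarith : sInf S < 2 * sInf S)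
  have hvmin : ∀ w ∈ eventProbs G, 0 < w → v ≤ w := fun w hw hw0 => by
    by_contra! hlt
    have h1 : sInf S ≤ w := csInf_le hSb ⟨hw, hw0⟩
    have h2 : sInf S ≤ v - w :=
      csInf_le hSb ⟨hA.sub_mem_eventProbs hw hv hlt.le, sub_pos.2 hlt⟩
    linarith
  have hfl : (⌊1 / v⌋₊ : ℝ) * v ≤ 1 := (le_div_iff₀ hv0).1 (Nat.floor_le (by positivity))
  have hfl2 := (div_lt_iff₀ hv0).1 (Nat.lt_floor_add_one (1 / v))
  -- A positive remainder would be an event probability below the minimum `v`.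
  have heq : (⌊1 / v⌋₊ : ℝ) * v = 1 := by
    refine hfl.antisymm (not_lt.1 fun hlt => ?_)
    have h1 := hvmin _ (hA.sub_mem_eventProbs (hA.nat_mul_mem_eventProbs hv _ hfl)
      one_mem_eventProbs hfl) (sub_pos.2 hlt)
    linarith
  set n := ⌊1 / v⌋₊
  have hn : n ≠ 0 := by
    intro h
    simp [h] at heq
  have hn0 : (0 : ℝ) < n := Nat.cast_pos.2 (Nat.pos_of_ne_zero hn)
  have hv1 : v = 1 / n := by
    rw [eq_div_iff hn0.ne', mul_comm, heq]
  refine ⟨n, Nat.pos_of_ne_zero hn, fun k hk => ?_, fun w hw hw0 => hv1 ▸ hvmin w hw hw0⟩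
  have h1 : (k : ℝ) * v = k / n := by rw [hv1, mul_one_div]
  rw [← h1]
  refine hA.nat_mul_mem_eventProbs hv k ?_
  rw [h1]
  exact (div_le_one hn0).2 (Nat.cast_le.2 hk)

/-- Since the transformations in condition (A) are bijections, (A) makes `G`, up to null sets, the
sigma-algebra generated by `n` intervals of equal length. -/
theorem ConditionA.exists_isUniformOnFin {hG : G ≤ F} {q : ℝ≥0∞} (hA : ConditionA hG q) :
    ∃ (n : ℕ) (X : Omega → Fin n), IsUniformOnFin (P.trim hG) X ∧
      ∀ f : Omega → ℝ, Measurable[G] f →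
        ∃ c : Fin n → ℝ, f =ᵐ[P.trim hG] fun x => c (X x) := by
  obtain ⟨n, hn, hmem, hmin⟩ := hA.exists_nat_div_mem_eventProbs
  have : NeZero n := ⟨hn.ne'⟩
  have hn0 : (0 : ℝ) < n := Nat.cast_pos.2 hn
  have hceil : EventuallyMeasurable G (ae P) fun x : Omega => (⌈n * (x : ℝ)⌉₊ : ℝ) := by
    refine @measurable_of_Iic _ _ _ _ _ (eventuallyMeasurableSpace G (ae P)) _ _ _ _ fun z => ?_
    by_cases hz : z < 0
    · convert @MeasurableSet.empty _ (eventuallyMeasurableSpace G (ae P)) using 1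
      ext x
      simp only [mem_preimage, mem_Iic, mem_empty_iff_false, iff_false, not_le]
      exact hz.trans_le (Nat.cast_nonneg _)
    · have hset : (fun x : Omega => (⌈n * (x : ℝ)⌉₊ : ℝ)) ⁻¹' Iic z
          = {x : Omega | (x : ℝ) ≤ (min ⌊z⌋₊ n : ℕ) / n} := by
        ext x
        have h1 : (n : ℝ) * x ≤ n := mul_le_of_le_one_right hn0.le x.2.2
        rw [mem_preimage, mem_Iic, ← Nat.le_floor_iff (not_lt.1 hz), Nat.ceil_le, mem_ofPred_eq,
          le_div_iff₀ hn0, mul_comm, Nat.cast_min, le_min_iff]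
        exact ⟨fun h => ⟨h, by linarith⟩, fun h => h.1⟩
      rw [hset]
      exact hA.eventuallyMeasurableSet_le (hmem _ (min_le_right _ _))
  obtain ⟨g, hg, hfg⟩ := exists_measurable_ae_eq_of_eventuallyMeasurable hceil
  -- Off the null point `0` the ceiling runs over `1, ..., n`, hence the shift by one. The reduction
  -- modulo `n` only matters on a null set.
  let X : Omega → Fin n := fun x => Fin.ofNat n (⌈g x⌉₊ - 1)
  have hXm : Measurable[G] X :=
    (measurable_from_top (f := fun k : ℕ => Fin.ofNat n (k - 1))).comp (Nat.measurable_ceil.comp hg)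
  have hXae : ∀ k : Fin n, X ⁻¹' {k} =ᵐ[P]
      {x : Omega | (x : ℝ) ≤ ((k + 1 : ℕ) : ℝ) / n} \ {x : Omega | (x : ℝ) ≤ ((k : ℕ) : ℝ) / n} :=
    fun k => by
      filter_upwards [hfg, compl_mem_ae_iff.2 (measure_singleton (μ := P) 0)] with x hx hx0
      have hx0' : (0 : ℝ) < x := lt_of_le_of_ne x.2.1 fun h => hx0 (Subtype.ext h.symm)
      have h1 : (n : ℝ) * x ≤ n := mul_le_of_le_one_right hn0.le x.2.2
      have h2 : ⌈(n : ℝ) * x⌉₊ ≤ n := Nat.ceil_le.2 h1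
      have h3 : 0 < ⌈(n : ℝ) * x⌉₊ := Nat.ceil_pos.2 (by positivity)
      refine propext ?_
      change Fin.ofNat n (⌈g x⌉₊ - 1) = k ↔ (x : ℝ) ≤ _ ∧ ¬ (x : ℝ) ≤ _
      rw [← hx, Nat.ceil_natCast, Fin.ext_iff, Fin.val_ofNat, Nat.mod_eq_of_lt (by omega),
        le_div_iff₀ hn0, le_div_iff₀ hn0, mul_comm (x : ℝ), ← Nat.ceil_le, ← Nat.ceil_le]
      omega
  have hXreal : ∀ k, P.real (X ⁻¹' {k}) = 1 / n := fun k => by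
    have h1 : ((k : ℕ) : ℝ) / n ≤ ((k + 1 : ℕ) : ℝ) / n := by
      gcongr
      omega
    refine (measureReal_congr (hXae k)).trans ((volume_real_sdiff_le
      (eventProbs_subset (hmem _ (by omega))).1 h1
      (eventProbs_subset (hmem _ (by omega))).2).trans ?_)
    push_cast
    ring
  have hXk : ∀ k, MeasurableSet[G] (X ⁻¹' {k}) := fun k => hXm (measurableSet_singleton k)
  refine ⟨n, X, ⟨hXm, fun k => ?_⟩, fun f hf => ?_⟩
  · rw [trim_measurableSet_eq hG (hXk k), ← ofReal_measureReal, hXreal, one_div,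
      ENNReal.ofReal_inv_of_pos hn0, ENNReal.ofReal_natCast]
  -- Each block has the least positive probability `1 / n`, so it is an atom: every event `f ⁻¹' U`
  -- either fills it or misses it up to a null set, which forces `f` to be constant there.
  · have hconst : ∀ k : Fin n, ∃ a : ℝ,
        f =ᶠ[ae ((P.trim hG).restrict (X ⁻¹' {k}))] Function.const Omega a := fun k => by
      refine Filter.exists_eventuallyEq_const_of_forall_separating MeasurableSet fun U hU => ?_
      have hfU : MeasurableSet[G] (f ⁻¹' U) := hf hU
      have hnull : ∀ B, MeasurableSet[G] B → P.real (B ∩ X ⁻¹' {k}) = 0 →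
          ∀ᵐ x ∂(P.trim hG).restrict (X ⁻¹' {k}), x ∉ B := fun B hB h => by
        rw [ae_iff]
        simp only [not_not]
        change (P.trim hG).restrict (X ⁻¹' {k}) B = 0
        rw [Measure.restrict_apply hB, trim_measurableSet_eq hG (hB.inter (hXk k))]
        exact (measureReal_eq_zero_iff).1 h
      by_cases h0 : P.real (f ⁻¹' U ∩ X ⁻¹' {k}) = 0
      · exact Or.inr (hnull _ hfU h0)
      · left
        have h1 := hmin _ ⟨_, hfU.inter (hXk k), rfl⟩ (measureReal_nonneg.lt_of_ne' h0)
        have h2 := measureReal_inter_add_sdiff (μ := P) (s := X ⁻¹' {k}) (hG _ hfU)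
        rw [hXreal, inter_comm, sdiff_eq, inter_comm (X ⁻¹' {k})] at h2
        have h3 : P.real ((f ⁻¹' U)ᶜ ∩ X ⁻¹' {k}) = 0 :=
          le_antisymm (by linarith) measureReal_nonneg
        filter_upwards [hnull _ hfU.compl h3] with x hx
        exact not_not.1 hx
    choose c hc using hconst
    refine ⟨c, ?_⟩
    have hc' : ∀ k, ∀ᵐ x ∂P.trim hG, x ∈ X ⁻¹' {k} → f x = c k := fun k =>
      (ae_restrict_iff' (hXk k)).1 (hc k)
    filter_upwards [ae_all_iff.2 hc'] with x hx
    exact hx (X x) rfl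

end RiskMeasure

theorem mainTheorem6 (G : MeasurableSpace RiskMeasure.Omega)
    (hG : G ≤ RiskMeasure.F)
    (p q : ℝ≥0∞) (hp : 1 ≤ p) (hp' : p ≠ ∞) (hpq : ENNReal.HolderConjugate p q)
    (hA : RiskMeasure.ConditionA hG q)
    (ϱ : RiskMeasure.SubLp hG p → ℝ)
    (hcoh : RiskMeasure.IsCoherent ϱ) (hlaw : RiskMeasure.IsLawInvariant ϱ) :
    RiskMeasure.IsRegular hG ϱ ∧ RiskMeasure.HasKusuokaRepresentation ϱ := by
  obtain ⟨n, X, hX, hrep⟩ := hA.exists_isUniformOnFin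
  exact RiskMeasure.isRegular_and_hasKusuokaRepresentation_of_isUniformOnFin hG hp hX hrep
    hcoh hlaw
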